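/- Let $n\ge 0$ be an integer, $m=\lfloor n/2\rfloor$ and $k>0$. Let $X\cdot Y=\sum_{i=1}^n x_iy_i-ts$ be the Lorentz inner product of $X=(x_1,\dots,x_n,t)$ and $Y=(y_1,\dots,y_n,s)$ in $\mathbb R^{n,1}$, let $e_1,\dots,e_n,e_0=\partial/\partial t$ be the standard basis, and let $$\mathbb H^n_{-k^2}=\{X=(x_1,\dots,x_n,t)\in\mathbb R^{n,1} : X\cdot X=-1/k^2,\ t>0\}$$ with the induced metric $g'$. It is parametrized by the unit ball of $\mathbb R^n$ through $$X=\frac1k\Big(\frac{2x}{1-|x|^2},\frac{1+|x|^2}{1-|x|^2}\Big),\qquad |x|<1 .$$ Let $c(e_1),\dots,c(e_n)$ be the following Clifford matrices on $\mathbb C^{2^m}=\mathbb C^2\otimes\cdots\otimes\mathbb C^2$. With $$g_1=\begin{pmatrix}\sqrt{-1}&0\\0&-\sqrt{-1}\end{pmatrix},\quad g_2=\begin{pmatrix}0&\sqrt{-1}\\\sqrt{-1}&0\end{pmatrix},\quad T=\begin{pmatrix}0&-\sqrt{-1}\\\sqrt{-1}&0\end{pmatrix},$$ for $1\le j\le 2m$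 put $c(e_j)=I\otimes\cdots\otimes I\otimes g_{\alpha}\otimes T\otimes\cdots\otimes T$ with $\lfloor (j-1)/2\rfloor$ factors $T$, where $\alpha=1$ for odd $j$ and $\alpha=2$ for even $j$; if $n=2m+1$, put $c(e_{n})=\sqrt{-1}\,T\otimes\cdots\otimes T$. Put $c(e_0)=\sqrt{-1}\,I$ and $c(x)=\sum_{j=1}^n x_jc(e_j)$ for $x\in\mathbb R^n$. Trivialize the spinor bundle of $\mathbb H^n_{-k^2}$ by the global orthonormal frame $\bar e_i=\frac{k(1-|x|^2)}{2}\frac{\partial}{\partial x_i}$ in ball coordinates. Thus spinor fields are $\mathbb C^{2^m}$-valued functions, $|\cdot|_{g'}$ is the standard Hermitian norm, Clifford multiplication is $c'(\bar e_i)=c(e_i)$, and the spin connection is $$\nabla'_V\psi=V(\psi)+\tfrac12\sum_{j<l}g'(\nabla_V\bar e_j,\bar e_l)\,c(e_j)c(e_l)\psi,$$ where $\nabla$ is the Levi-Civita connection of $g'$. A Killing spinor is a smooth spinor field $\phi'$ with $\nabla'_V\phi'+\frac{\sqrt{-1}}{2}k\,c'(V)\phi'=0$ for every tangent vector $V$.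 For $a\in\mathbb C^{2^m}$ let $\phi'_{a,0}$ be the spinor field given in ball coordinates by $$\phi'_{a,0}(x)=\sqrt{\frac{2}{1-|x|^2}}\,\big(a-\sqrt{-1}\,c(x)a\big).$$ Then $\phi'_{a,0}$ is a Killing spinor, every Killing spinor on $\mathbb H^n_{-k^2}$ is $\phi'_{b,0}$ for a unique $b\in\mathbb C^{2^m}$, and at every point $X\in\mathbb H^n_{-k^2}$ $$|\phi'_{a,0}|_{g'}^2=-2k\,X\cdot\zeta_a,\qquad \zeta_a=\sum_{j=1}^n\langle\sqrt{-1}\,c(e_j)a,a\rangle e_j-\langle\sqrt{-1}\,c(e_0)a,a\rangle e_0\in\mathbb R^{n,1},$$ where $\langle\cdot,\cdot\rangle$ is the standard Hermitian inner product of $\mathbb C^{2^m}$. -/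

import Mathlib

open scoped ContDiff

noncomputable section

namespace HyperbolicSpinor

/-! ### Clifford matrices -/

/-- The matrix `g₁`. -/
def g₁ : Matrix (Fin 2) (Fin 2) ℂ := !![Complex.I, 0; 0, -Complex.I]

/-- The matrix `g₂`. -/
def g₂ : Matrix (Fin 2) (Fin 2) ℂ := !![0, Complex.I; Complex.I, 0]

/-- The matrix `T`. -/
def T : Matrix (Fin 2) (Fin 2) ℂ := !![0, -Complex.I; Complex.I, 0]

/-- The spinor module `ℂ^(2^m) = ℂ² ⊗ ⋯ ⊗ ℂ²` (`m = ⌊n/2⌋` factors) with its standard Hermitian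
inner product. Its standard basis is indexed by `{0,1}^m`; the factor with label `s` is the one
which has `s` factors to its right. -/
abbrev Spinor (n : ℕ) := EuclideanSpace ℂ (Fin (n / 2) → Fin 2)

/-- The factor with label `s` (counted from the right, from `0`) of the `j`-th Clifford matrix
(counted from `0`). -/
def cliffordFactor (j s : ℕ) : Matrix (Fin 2) (Fin 2) ℂ :=
  if s < j / 2 then T else if s = j / 2 then (if Even j then g₁ else g₂) else 1

/-- The Clifford matrices. With `j` counted from `0` and `m = ⌊n/2⌋`: for `j < 2m` it is
`1 ⊗ ⋯ ⊗ 1 ⊗ g ⊗ T ⊗ ⋯ ⊗ T` with `⌊j/2⌋` factors `T`, where `g = g₁` for even and `g = g₂` for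
odd `j`; for odd `n` and `j = 2m` it is `√-1 T ⊗ ⋯ ⊗ T`. -/
def cliffordMatrix (n : ℕ) (j : Fin n) :
    Matrix (Fin (n / 2) → Fin 2) (Fin (n / 2) → Fin 2) ℂ := fun p q =>
  (if (j : ℕ) = 2 * (n / 2) then Complex.I else 1) *
    ∏ s : Fin (n / 2), cliffordFactor j s (p s) (q s)

/-- `c(e_j)` acting on spinors. -/
def c {n : ℕ} (j : Fin n) : Spinor n →ₗ[ℂ] Spinor n :=
  Matrix.toEuclideanLin (cliffordMatrix n j)

/-- `c(v) = ∑ v_j c(e_j)` for `v ∈ ℝⁿ`. -/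
def cliff {n : ℕ} (v : EuclideanSpace ℝ (Fin n)) (s : Spinor n) : Spinor n :=
  ∑ j, (v j : ℂ) • c j s

/-! ### Minkowski space, the hyperboloid and its ball coordinates -/

/-- `ℝ^{n,1}`, with points `(x, t)`, `x ∈ ℝⁿ`, `t ∈ ℝ`. -/
abbrev Minkowski (n : ℕ) := EuclideanSpace ℝ (Fin n) × ℝ

/-- The Lorentz inner product `∑ xᵢ yᵢ - t s`. -/
def lorentz {n : ℕ} (P Q : Minkowski n) : ℝ := ∑ i, P.1 i * Q.1 i - P.2 * Q.2

/-- The hyperboloid model of the hyperbolic space of curvature `-k²`. -/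
def hyperboloid (n : ℕ) (k : ℝ) : Set (Minkowski n) :=
  {P | ∑ i, P.1 i ^ 2 - P.2 ^ 2 = -(1 / k ^ 2) ∧ 0 < P.2}

/-- The diffeomorphism from the unit ball (ball model) onto the hyperboloid. -/
def ofBall {n : ℕ} (k : ℝ) (x : EuclideanSpace ℝ (Fin n)) : Minkowski n :=
  ((1 / k * (2 / (1 - ‖x‖ ^ 2))) • x, 1 / k * ((1 + ‖x‖ ^ 2) / (1 - ‖x‖ ^ 2)))

/-- The inverse of `ofBall`: the coordinate of a point of the hyperboloid in the unit ball. -/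
def toBall {n : ℕ} (k : ℝ) (P : Minkowski n) : EuclideanSpace ℝ (Fin n) :=
  (k / (1 + k * P.2)) • P.1

/-! ### Riemannian geometry in one chart -/

/-- The coordinate vector `∂_i`. -/
abbrev coordVec {n : ℕ} (i : Fin n) : EuclideanSpace ℝ (Fin n) := EuclideanSpace.single i 1

/-- Partial derivative of a real function. -/
def partialD {n : ℕ} (i : Fin n) (f : EuclideanSpace ℝ (Fin n) → ℝ)
    (x : EuclideanSpace ℝ (Fin n)) : ℝ := fderiv ℝ f x (coordVec i)

/-- The inner product of two tangent vectors at `x` for a metric with coefficients `g i j`. -/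
def metricInner {n : ℕ} (g : EuclideanSpace ℝ (Fin n) → Matrix (Fin n) (Fin n) ℝ)
    (x V W : EuclideanSpace ℝ (Fin n)) : ℝ := ∑ i, ∑ j, g x i j * V i * W j

/-- The Christoffel symbol `Γ^l_{ij}` of a metric. -/
def christoffel {n : ℕ} (g : EuclideanSpace ℝ (Fin n) → Matrix (Fin n) (Fin n) ℝ)
    (x : EuclideanSpace ℝ (Fin n)) (l i j : Fin n) : ℝ :=
  1 / 2 * ∑ p, (g x)⁻¹ l p * (partialD i (fun y => g y j p) x + partialD j (fun y => g y i p) x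
    - partialD p (fun y => g y i j) x)

/-- The Levi-Civita covariant derivative `∇_V W` at `x` of a vector field `W`. -/
def leviCivita {n : ℕ} (g : EuclideanSpace ℝ (Fin n) → Matrix (Fin n) (Fin n) ℝ)
    (x V : EuclideanSpace ℝ (Fin n)) (W : EuclideanSpace ℝ (Fin n) → EuclideanSpace ℝ (Fin n)) :
    EuclideanSpace ℝ (Fin n) :=
  fderiv ℝ W x V + WithLp.toLp 2 (fun l => ∑ i, ∑ j, christoffel g x l i j * V i * W x j)

/-- The spin connection `∇_V ψ` at `x`, for a spinor field `ψ` written in the trivialization of the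
spinor bundle given by a global `g`-orthonormal frame `e`:
`∇_V ψ = V(ψ) + 1/2 ∑_{j<l} ⟨∇_V e_j, e_l⟩ c(e_j) c(e_l) ψ`. -/
def spinConnection {n : ℕ} (g : EuclideanSpace ℝ (Fin n) → Matrix (Fin n) (Fin n) ℝ)
    (e : Fin n → EuclideanSpace ℝ (Fin n) → EuclideanSpace ℝ (Fin n))
    (ψ : EuclideanSpace ℝ (Fin n) → Spinor n) (x V : EuclideanSpace ℝ (Fin n)) : Spinor n :=
  fderiv ℝ ψ x V + (1 / 2 : ℂ) • ∑ j, ∑ l with j < l,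
    ((metricInner g x (leviCivita g x V (e j)) (e l x) : ℝ) : ℂ) • c j (c l (ψ x))

/-- Clifford multiplication by a tangent vector `V` at `x` in the trivialization given by a
`g`-orthonormal frame `e`. -/
def cliffordMul {n : ℕ} (g : EuclideanSpace ℝ (Fin n) → Matrix (Fin n) (Fin n) ℝ)
    (e : Fin n → EuclideanSpace ℝ (Fin n) → EuclideanSpace ℝ (Fin n))
    (x V : EuclideanSpace ℝ (Fin n)) (s : Spinor n) : Spinor n :=
  ∑ j, ((metricInner g x V (e j x) : ℝ) : ℂ) • c j s

/-! ### Killing spinors on hyperbolic space -/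

/-- The hyperbolic metric in ball coordinates: the metric induced on the hyperboloid by the
Lorentz metric. -/
def hypMetric {n : ℕ} (k : ℝ) (x : EuclideanSpace ℝ (Fin n)) : Matrix (Fin n) (Fin n) ℝ :=
  fun i j => lorentz (fderiv ℝ (ofBall k) x (coordVec i)) (fderiv ℝ (ofBall k) x (coordVec j))

/-- The global orthonormal frame of the hyperbolic metric that is proportional to the coordinate
frame of the ball. -/
def hypFrame {n : ℕ} (k : ℝ) (i : Fin n) (x : EuclideanSpace ℝ (Fin n)) :
    EuclideanSpace ℝ (Fin n) := (k * (1 - ‖x‖ ^ 2) / 2) • coordVec i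

/-- A Killing spinor: a smooth spinor field `φ` with `∇_V φ + (√-1/2) k c(V) φ = 0` for all tangent
vectors `V`. The spinor bundle is trivialized by `hypFrame`, so that a spinor field is a
`Spinor n`-valued function on the hyperboloid and its pointwise norm is the Hermitian norm. The
function `φ` is evaluated only on the hyperboloid. -/
def IsKillingSpinor {n : ℕ} (k : ℝ) (φ : Minkowski n → Spinor n) : Prop :=
  ContDiffOn ℝ ∞ (fun x => φ (ofBall k x)) (Metric.ball 0 1) ∧
  ∀ x ∈ Metric.ball (0 : EuclideanSpace ℝ (Fin n)) 1, ∀ V : EuclideanSpace ℝ (Fin n),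
    spinConnection (hypMetric k) (hypFrame k) (fun y => φ (ofBall k y)) x V
      + (Complex.I / 2 * (k : ℂ)) • cliffordMul (hypMetric k) (hypFrame k) x V (φ (ofBall k x)) = 0

/-- The spinor field `φ_a` corresponding to `a`, given in the ball coordinate `x` by
`√(2 / (1 - |x|²)) (a - √-1 c(x) a)`. -/
def killingSpinor {n : ℕ} (k : ℝ) (a : Spinor n) (P : Minkowski n) : Spinor n :=
  ((√(2 / (1 - ‖toBall k P‖ ^ 2)) : ℝ) : ℂ) • (a - Complex.I • cliff (toBall k P) a)

/-- `ζ_a = ∑_j ⟨√-1 c(e_j) a, a⟩ e_j - ⟨√-1 c(e_0) a, a⟩ e_0` with `c(e_0) = √-1`. These numbers are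
real, see `zeta_fst` and `zeta_snd`. -/
def zeta {n : ℕ} (a : Spinor n) : Minkowski n :=
  (WithLp.toLp 2 (fun j => (inner ℂ a (Complex.I • c j a)).re),
    -(inner ℂ a (Complex.I • (Complex.I • a))).re)

theorem cliffordMatrix_conjTranspose (n : ℕ) (j : Fin n) :
    (cliffordMatrix n j).conjTranspose = -cliffordMatrix n j := by
  have hT : ∀ x y, star (T y x) = T x y := by
    intro x y; fin_cases x <;> fin_cases y <;> simp [T]
  have h1 : ∀ x y, star (g₁ y x) = -g₁ x y := by
    intro x y; fin_cases x <;> fin_cases y <;> simp [g₁]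
  have h2 : ∀ x y, star (g₂ y x) = -g₂ x y := by
    intro x y; fin_cases x <;> fin_cases y <;> simp [g₂]
  have h0 : ∀ x y, star ((1 : Matrix (Fin 2) (Fin 2) ℂ) y x) = (1 : Matrix (Fin 2) (Fin 2) ℂ) x y := by
    intro x y; fin_cases x <;> fin_cases y <;> simp
  have hF : ∀ s x y, star (cliffordFactor j s y x) =
      (if s = (j : ℕ) / 2 then -1 else 1) * cliffordFactor j s x y := by
    intro s x y
    unfold cliffordFactor
    split_ifs <;> first | omega | simp only [hT, h1, h2, h0, one_mul, neg_mul]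
  ext p q
  simp only [Matrix.conjTranspose_apply, Matrix.neg_apply, cliffordMatrix, star_mul', star_prod, hF,
    Finset.prod_mul_distrib]
  have hj := j.2
  by_cases h : (j : ℕ) = 2 * (n / 2)
  · have h' : ∀ s : Fin (n / 2), ¬ ((s : ℕ) = (j : ℕ) / 2) := fun s => by
      have := s.2
      omega
    simp only [h', if_false, Finset.prod_const_one, one_mul]
    simp [h]
  · have h' : ∀ s : Fin (n / 2), ((s : ℕ) = (j : ℕ) / 2) ↔ s = ⟨(j : ℕ) / 2, by omega⟩ :=
      fun s => by rw [Fin.ext_iff]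
    simp only [h', Finset.prod_ite_eq', Finset.mem_univ, if_true]
    simp [h]

theorem zeta_fst {n : ℕ} (a : Spinor n) (j : Fin n) :
    (((zeta a).1 j : ℝ) : ℂ) = inner ℂ a (Complex.I • c j a) := by
  have h : inner ℂ (c j a) a = -inner ℂ a (c j a) := by
    rw [c, ← LinearMap.adjoint_inner_right, ← Matrix.toEuclideanLin_conjTranspose_eq_adjoint,
      cliffordMatrix_conjTranspose, map_neg, LinearMap.neg_apply, inner_neg_right]
  refine Complex.conj_eq_iff_re.mp ?_
  rw [inner_conj_symm, inner_smul_left, inner_smul_right, h]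
  simp

theorem zeta_snd {n : ℕ} (a : Spinor n) :
    (((zeta a).2 : ℝ) : ℂ) = -inner ℂ a (Complex.I • (Complex.I • a)) := by
  have h : inner ℂ a (Complex.I • (Complex.I • a)) = ((-‖a‖ ^ 2 : ℝ) : ℂ) := by
    rw [smul_smul, Complex.I_mul_I, neg_one_smul, inner_neg_right, inner_self_eq_norm_sq_to_K]
    simp
  simp only [zeta]
  rw [h, Complex.ofReal_neg, Complex.ofReal_re]

end HyperbolicSpinor

end

/-!
Put `J v = √-1 c(v)`, so that `J v ^ 2 = |v|²`. The hyperbolic metric is conformally flat in ball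
coordinates, and in its conformal frame the Killing equation becomes a flat linear system
`dψ(V) = M(V) ψ`. This system is solved by `P = √(2 / (1 - |x|²)) (1 - J x)`, and the derivative of
its conjugate `P' = √(2 / (1 - |x|²)) (1 + J x)` is `-P' M`. Hence `P' ψ` is constant along every
solution `ψ`, and `P' P = 2` recovers `ψ` from that constant.
-/

noncomputable section

namespace HyperbolicSpinor

open scoped RealInnerProductSpace Topology

theorem one_sub_norm_sq_pos {E : Type*} [SeminormedAddCommGroup E] {x : E}
    (hx : x ∈ Metric.ball 0 1) :
    0 < 1 - ‖x‖ ^ 2 := by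
  rw [mem_ball_zero_iff] at hx
  nlinarith [norm_nonneg x]

theorem eventually_one_sub_norm_sq_ne_zero {E : Type*} [SeminormedAddCommGroup E] {x : E}
    (hx : 1 - ‖x‖ ^ 2 ≠ 0) : ∀ᶠ y in 𝓝 x, 1 - ‖y‖ ^ 2 ≠ 0 :=
  ContinuousAt.eventually_ne (by fun_prop) hx

section BallFactor

variable {E : Type*} [NormedAddCommGroup E] [InnerProductSpace ℝ E] {x : E}

theorem hasFDerivAt_const_div_one_sub_norm_sq (b : ℝ) (hx : 1 - ‖x‖ ^ 2 ≠ 0) :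
    HasFDerivAt (fun y : E => b / (1 - ‖y‖ ^ 2))
      ((b / (1 - ‖x‖ ^ 2)) • innerSL ℝ ((2 / (1 - ‖x‖ ^ 2)) • x)) x := by
  have h := (hasStrictFDerivAt_norm_sq x).hasFDerivAt.const_sub 1
  refine (((hasDerivAt_inv hx).comp_hasFDerivAt x h).const_mul b).congr_fderiv ?_
  ext v
  simp only [smul_apply, smul_eq_mul, neg_apply, innerSL_apply_apply, nsmul_eq_mul,
    real_inner_smul_left, Nat.cast_ofNat]
  field_simp

theorem hasFDerivAt_sqrt_two_div_one_sub_norm_sq (hx : x ∈ Metric.ball 0 1) :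
    HasFDerivAt (fun y : E => √(2 / (1 - ‖y‖ ^ 2)))
      ((√(2 / (1 - ‖x‖ ^ 2)) / (1 - ‖x‖ ^ 2)) • innerSL ℝ x) x := by
  have hr := one_sub_norm_sq_pos hx
  have hpos : 0 < 2 / (1 - ‖x‖ ^ 2) := by positivity
  refine ((hasFDerivAt_const_div_one_sub_norm_sq 2 hr.ne').sqrt hpos.ne').congr_fderiv ?_
  rw [map_smul, smul_smul, smul_smul]
  congr 1
  have hs := Real.sqrt_pos.mpr hpos
  have hs2 : √(2 / (1 - ‖x‖ ^ 2)) ^ 2 * (1 - ‖x‖ ^ 2) = 2 := by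
    rw [Real.sq_sqrt hpos.le, div_mul_cancel₀ _ hr.ne']
  generalize √(2 / (1 - ‖x‖ ^ 2)) = s at hs hs2 ⊢
  field_simp
  linarith

theorem contDiffOn_sqrt_two_div_one_sub_norm_sq :
    ContDiffOn ℝ ∞ (fun y : E => √(2 / (1 - ‖y‖ ^ 2))) (Metric.ball 0 1) :=
  (contDiffOn_const.div (contDiff_const.sub (contDiff_norm_sq ℝ)).contDiffOn
    fun _ hx => (one_sub_norm_sq_pos hx).ne').sqrt
    fun _ hx => (div_pos two_pos (one_sub_norm_sq_pos hx)).ne'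

end BallFactor

section KillingPropagator

variable {E A : Type*} [NormedAddCommGroup E] [InnerProductSpace ℝ E] [NormedRing A]
  [NormedAlgebra ℝ A] {J : E →L[ℝ] A} {x : E}

/-- A Clifford map for the positive definite form `‖·‖²`. Clifford multiplication of spinors squares
to `-‖v‖²`, so that the Clifford map which goes with it is `J v = √-1 c(v)`; all complex numbers in
the Killing equation are absorbed in `J`. -/
def IsClifford (J : E →L[ℝ] A) : Prop := ∀ v, J v * J v = ‖v‖ ^ 2 • (1 : A)

theorem IsClifford.neg (hJ : IsClifford J) : IsClifford (-J) := fun v => by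
  simpa only [neg_apply, neg_mul_neg] using hJ v

theorem IsClifford.mul_swap (hJ : IsClifford J) (v w : E) :
    J v * J w = (2 * ⟪v, w⟫) • (1 : A) - J w * J v := by
  have h := hJ (v + w)
  rw [map_add, add_mul, mul_add, mul_add, hJ, hJ, norm_add_sq_real] at h
  rw [eq_sub_iff_add_eq, ← sub_eq_zero]
  rw [← sub_eq_zero] at h
  rw [← h]
  module

/-- The map which takes the vector `a` to the value at `x` of the Killing spinor that belongs to
`a`. -/
def killingPropagator (J : E →L[ℝ] A) (x : E) : A := √(2 / (1 - ‖x‖ ^ 2)) • (1 - J x)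

/-- The form `M` for which the Killing equation reads `dψ(V) = M(V) ψ` in ball coordinates. -/
def killingForm (J : E →L[ℝ] A) (x : E) : E →L[ℝ] A :=
  (1 - ‖x‖ ^ 2)⁻¹ • (ContinuousLinearMap.mul ℝ A (J x) ∘L J - (innerSL ℝ x).smulRight 1 - J)

theorem killingForm_apply (J : E →L[ℝ] A) (x V : E) :
    killingForm J x V = (1 - ‖x‖ ^ 2)⁻¹ • (J x * J V - ⟪x, V⟫ • 1 - J V) := rfl

theorem contDiffOn_killingPropagator (J : E →L[ℝ] A) :
    ContDiffOn ℝ ∞ (killingPropagator J) (Metric.ball 0 1) :=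
  contDiffOn_sqrt_two_div_one_sub_norm_sq.smul (contDiff_const.sub J.contDiff).contDiffOn

theorem IsClifford.killingPropagator_neg_mul (hJ : IsClifford J) (hx : x ∈ Metric.ball 0 1) :
    killingPropagator (-J) x * killingPropagator J x = (2 : ℝ) • 1 := by
  have hr := one_sub_norm_sq_pos hx
  have hJx : (1 + J x) * (1 - J x) = (1 - ‖x‖ ^ 2) • (1 : A) := by
    rw [mul_sub, add_mul, add_mul, hJ, one_mul, mul_one, one_mul]
    module
  rw [killingPropagator, killingPropagator, neg_apply, sub_neg_eq_add, smul_mul_smul_comm, hJx,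
    smul_smul, Real.mul_self_sqrt (by positivity), div_mul_cancel₀ _ hr.ne']

theorem hasFDerivAt_killingPropagator_of_linear (J : E →L[ℝ] A) (hx : x ∈ Metric.ball 0 1) :
    HasFDerivAt (killingPropagator J) (√(2 / (1 - ‖x‖ ^ 2)) •
      ((1 - ‖x‖ ^ 2)⁻¹ • (innerSL ℝ x).smulRight (1 - J x) - J)) x := by
  refine ((hasFDerivAt_sqrt_two_div_one_sub_norm_sq hx).fun_smul
    (J.hasFDerivAt.const_sub 1)).congr_fderiv ?_
  ext V
  simp only [add_apply, sub_apply, neg_apply, smul_apply, ContinuousLinearMap.smulRight_apply,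
    smul_eq_mul]
  module

theorem IsClifford.killingForm_mul (hJ : IsClifford J) (hx : x ∈ Metric.ball 0 1) (V : E) :
    killingForm J x V * killingPropagator J x =
      √(2 / (1 - ‖x‖ ^ 2)) • ((1 - ‖x‖ ^ 2)⁻¹ • ⟪x, V⟫ • (1 - J x) - J V) := by
  have hr := (one_sub_norm_sq_pos hx).ne'
  have hswap : J x * J V * J x = (2 * ⟪x, V⟫) • J x - ‖x‖ ^ 2 • J V := by
    rw [hJ.mul_swap, sub_mul, mul_assoc, hJ, smul_one_mul, mul_smul_one]
  have hmul : (J x * J V - ⟪x, V⟫ • 1 - J V) * (1 - J x) =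
      ⟪x, V⟫ • (1 - J x) - (1 - ‖x‖ ^ 2) • J V := by
    simp only [mul_sub, sub_mul, mul_one, smul_one_mul, hswap, hJ.mul_swap V x,
      real_inner_comm x V]
    module
  rw [killingForm_apply, killingPropagator, smul_mul_smul_comm, hmul, mul_comm, mul_smul, smul_sub,
    inv_smul_smul₀ hr]

theorem IsClifford.killingPropagator_neg_mul_killingForm (hJ : IsClifford J)
    (hx : x ∈ Metric.ball 0 1) (V : E) : killingPropagator (-J) x * killingForm J x V =
      -(√(2 / (1 - ‖x‖ ^ 2)) • ((1 - ‖x‖ ^ 2)⁻¹ • ⟪x, V⟫ • (1 + J x) + J V)) := by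
  have hr := (one_sub_norm_sq_pos hx).ne'
  have hmul : (1 + J x) * (J x * J V - ⟪x, V⟫ • 1 - J V) =
      -(⟪x, V⟫ • (1 + J x) + (1 - ‖x‖ ^ 2) • J V) := by
    simp only [mul_sub, add_mul, one_mul, mul_smul_one, ← mul_assoc, hJ x]
    rw [smul_one_mul]
    module
  rw [killingForm_apply, killingPropagator, neg_apply, sub_neg_eq_add, smul_mul_smul_comm, hmul,
    mul_smul, smul_neg, smul_neg, smul_add, inv_smul_smul₀ hr]

theorem IsClifford.hasFDerivAt_killingPropagator (hJ : IsClifford J)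
    (hx : x ∈ Metric.ball 0 1) : HasFDerivAt (killingPropagator J)
      ((ContinuousLinearMap.mul ℝ A).flip (killingPropagator J x) ∘L killingForm J x) x :=
  (hasFDerivAt_killingPropagator_of_linear J hx).congr_fderiv <| by
    ext V
    exact (hJ.killingForm_mul hx V).symm

theorem IsClifford.hasFDerivAt_killingPropagator_neg (hJ : IsClifford J)
    (hx : x ∈ Metric.ball 0 1) : HasFDerivAt (killingPropagator (-J))
      (-(ContinuousLinearMap.mul ℝ A (killingPropagator (-J) x) ∘L killingForm J x)) x :=
  (hasFDerivAt_killingPropagator_of_linear (-J) hx).congr_fderiv <| by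
    ext V
    refine Eq.trans ?_ (neg_eq_iff_eq_neg.mpr (hJ.killingPropagator_neg_mul_killingForm hx V)).symm
    simp

end KillingPropagator

section KillingSolutions

variable {E S : Type*} [NormedAddCommGroup E] [InnerProductSpace ℝ E] [NormedAddCommGroup S]
  [NormedSpace ℝ S] {J : E →L[ℝ] S →L[ℝ] S} {x : E}

theorem IsClifford.killingPropagator_neg_apply (hJ : IsClifford J) (hx : x ∈ Metric.ball 0 1)
    (a : S) : killingPropagator (-J) x (killingPropagator J x a) = (2 : ℝ) • a :=
  DFunLike.congr_fun (hJ.killingPropagator_neg_mul hx) a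

theorem IsClifford.killingPropagator_injective (hJ : IsClifford J) (hx : x ∈ Metric.ball 0 1) :
    Function.Injective ⇑(killingPropagator J x) := fun a b hab => by
  have h := congrArg ⇑(killingPropagator (-J) x) hab
  simp only [hJ.killingPropagator_neg_apply hx] at h
  exact smul_right_injective S two_ne_zero h

theorem IsClifford.hasFDerivAt_killingPropagator_apply (hJ : IsClifford J)
    (hx : x ∈ Metric.ball 0 1) (a : S) : HasFDerivAt (fun y => killingPropagator J y a)
      ((killingForm J x).flip (killingPropagator J x a)) x :=
  ((hJ.hasFDerivAt_killingPropagator hx).clm_apply (hasFDerivAt_const a x)).congr_fderiv <| by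
    ext V; simp

theorem IsClifford.hasFDerivAt_killingPropagator_neg_apply_zero (hJ : IsClifford J) {ψ : E → S}
    (hx : x ∈ Metric.ball 0 1) (hψ : HasFDerivAt ψ ((killingForm J x).flip (ψ x)) x) :
    HasFDerivAt (fun y => killingPropagator (-J) y (ψ y)) (0 : E →L[ℝ] S) x :=
  ((hJ.hasFDerivAt_killingPropagator_neg hx).clm_apply hψ).congr_fderiv <| by
    ext V; simp

theorem IsClifford.exists_eqOn_killingPropagator (hJ : IsClifford J) {ψ : E → S}
    (hψ : ∀ x ∈ Metric.ball 0 1, HasFDerivAt ψ ((killingForm J x).flip (ψ x)) x) :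
    ∃ a, Set.EqOn ψ (fun x => killingPropagator J x a) (Metric.ball 0 1) := by
  have hderiv := fun x hx => hJ.hasFDerivAt_killingPropagator_neg_apply_zero hx (hψ x hx)
  have hconst : ∀ x ∈ Metric.ball (0 : E) 1,
      killingPropagator (-J) x (ψ x) = killingPropagator (-J) 0 (ψ 0) := fun x hx =>
    Metric.isOpen_ball.is_const_of_fderiv_eq_zero (convex_ball _ _).isPreconnected
      (fun y hy => (hderiv y hy).differentiableAt.differentiableWithinAt)
      (fun y hy => (hderiv y hy).fderiv) hx (Metric.mem_ball_self one_pos)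
  refine ⟨(2 : ℝ)⁻¹ • killingPropagator (-J) 0 (ψ 0), fun x hx => ?_⟩
  refine hJ.neg.killingPropagator_injective hx ?_
  simp only [hJ.killingPropagator_neg_apply hx, hconst x hx, smul_inv_smul₀ (two_ne_zero' ℝ)]

theorem IsClifford.norm_killingPropagator_sq {𝕜 : Type*} [RCLike 𝕜] [InnerProductSpace 𝕜 S]
    [IsScalarTower ℝ 𝕜 S] (hJ : IsClifford J) (hx : x ∈ Metric.ball 0 1)
    (hsymm : ∀ s t, inner 𝕜 (J x s) t = inner 𝕜 s (J x t)) (a : S) :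
    ‖killingPropagator J x a‖ ^ 2 =
      2 / (1 - ‖x‖ ^ 2) * ((1 + ‖x‖ ^ 2) * ‖a‖ ^ 2 - 2 * RCLike.re (inner 𝕜 a (J x a))) := by
  have hr := one_sub_norm_sq_pos hx
  have hJa : J x (J x a) = ‖x‖ ^ 2 • a := DFunLike.congr_fun (hJ x) a
  have hnorm : ‖J x a‖ ^ 2 = ‖x‖ ^ 2 * ‖a‖ ^ 2 := by
    rw [← inner_self_eq_norm_sq (𝕜 := 𝕜), hsymm, hJa, inner_smul_right_eq_smul, RCLike.smul_re,
      inner_self_eq_norm_sq]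
  rw [killingPropagator, smul_apply, norm_smul, mul_pow, Real.norm_eq_abs, sq_abs,
    Real.sq_sqrt (by positivity), sub_apply, norm_sub_sq (𝕜 := 𝕜), one_apply_eq_self,
    hnorm]
  ring

end KillingSolutions

section TensorMatrix

variable {ι κ R : Type*} [Fintype ι] [CommSemiring R]

/-- The tensor product of a family of square matrices of the same size, its rows and columns being
indexed by families of indices. -/
def tensorMatrix (F : ι → Matrix κ κ R) : Matrix (ι → κ) (ι → κ) R :=
  fun p q => ∏ s, F s (p s) (q s)

theorem tensorMatrix_mul [DecidableEq ι] [Fintype κ] (F G : ι → Matrix κ κ R) :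
    tensorMatrix F * tensorMatrix G = tensorMatrix (fun s => F s * G s) := by
  ext p q
  simp only [Matrix.mul_apply, tensorMatrix, ← Finset.prod_mul_distrib]
  rw [Finset.prod_univ_sum, Fintype.piFinset_univ]

theorem tensorMatrix_smul (ε : ι → R) (F : ι → Matrix κ κ R) :
    tensorMatrix (fun s => ε s • F s) = (∏ s, ε s) • tensorMatrix F := by
  ext p q
  simp [tensorMatrix, Finset.prod_mul_distrib]

theorem tensorMatrix_one [DecidableEq κ] :
    tensorMatrix (fun _ : ι => (1 : Matrix κ κ R)) = 1 := by
  ext p q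
  by_cases h : p = q
  · subst h
    simp [tensorMatrix]
  · obtain ⟨s, hs⟩ := Function.ne_iff.mp h
    rw [Matrix.one_apply_ne h]
    exact Finset.prod_eq_zero (Finset.mem_univ s) (Matrix.one_apply_ne hs)

end TensorMatrix

section CliffordMatrices

theorem T_mul_T : T * T = 1 := by
  ext i j; fin_cases i <;> fin_cases j <;> simp [T]

theorem g₁_mul_g₁ : g₁ * g₁ = -1 := by
  ext i j; fin_cases i <;> fin_cases j <;> simp [g₁]

theorem g₂_mul_g₂ : g₂ * g₂ = -1 := by
  ext i j; fin_cases i <;> fin_cases j <;> simp [g₂]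

theorem g₁_mul_T : g₁ * T = -(T * g₁) := by
  ext i j; fin_cases i <;> fin_cases j <;> simp [g₁, T]

theorem g₂_mul_T : g₂ * T = -(T * g₂) := by
  ext i j; fin_cases i <;> fin_cases j <;> simp [g₂, T]

theorem g₁_mul_g₂ : g₁ * g₂ = -(g₂ * g₁) := by
  ext i j; fin_cases i <;> fin_cases j <;> simp [g₁, g₂]

theorem cliffordFactor_mul_self (j s : ℕ) :
    cliffordFactor j s * cliffordFactor j s = (if s = j / 2 then (-1 : ℂ) else 1) • 1 := by
  unfold cliffordFactor
  split_ifs <;> first | omega | simp [T_mul_T, g₁_mul_g₁, g₂_mul_g₂]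

theorem cliffordFactor_mul_comm {i j : ℕ} (h : i < j) (s : ℕ) :
    cliffordFactor i s * cliffordFactor j s =
      (if s = i / 2 then (-1 : ℂ) else 1) • (cliffordFactor j s * cliffordFactor i s) := by
  unfold cliffordFactor
  simp only [Nat.even_iff]
  split_ifs <;> first | omega | simp [g₁_mul_T, g₂_mul_T, g₁_mul_g₂]

theorem prod_ite_val_eq {M : Type*} [CommMonoid M] (m r : ℕ) (z : M) :
    ∏ s : Fin m, (if (s : ℕ) = r then z else 1) = if r < m then z else 1 := by
  rw [Fin.prod_univ_eq_prod_range (fun s => if s = r then z else 1), Finset.prod_ite_eq']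
  simp only [Finset.mem_range]

variable {n : ℕ} {i j : Fin n}

theorem cliffordMatrix_eq_smul_tensorMatrix (j : Fin n) :
    cliffordMatrix n j = (if (j : ℕ) = 2 * (n / 2) then Complex.I else 1) •
      tensorMatrix (fun s : Fin (n / 2) => cliffordFactor j s) := rfl

theorem cliffordMatrix_mul_self (j : Fin n) : cliffordMatrix n j * cliffordMatrix n j = -1 := by
  have hj := j.2
  rw [cliffordMatrix_eq_smul_tensorMatrix, smul_mul_smul_comm, tensorMatrix_mul]
  simp only [cliffordFactor_mul_self]
  rw [tensorMatrix_smul fun s : Fin (n / 2) => if (s : ℕ) = (j : ℕ) / 2 then (-1 : ℂ) else 1,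
    tensorMatrix_one, prod_ite_val_eq, smul_smul]
  split_ifs <;> first | omega | simp

theorem cliffordMatrix_mul_comm_of_lt (h : i < j) :
    cliffordMatrix n i * cliffordMatrix n j = -(cliffordMatrix n j * cliffordMatrix n i) := by
  have hi : (i : ℕ) / 2 < n / 2 := by omega
  simp only [cliffordMatrix_eq_smul_tensorMatrix, smul_mul_smul_comm, tensorMatrix_mul,
    cliffordFactor_mul_comm h]
  rw [tensorMatrix_smul fun s : Fin (n / 2) => if (s : ℕ) = (i : ℕ) / 2 then (-1 : ℂ) else 1,
    prod_ite_val_eq, if_pos hi, neg_one_smul, smul_neg, mul_comm]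

theorem c_apply_c (i j : Fin n) (s : Spinor n) :
    c i (c j s) = Matrix.toEuclideanLin (cliffordMatrix n i * cliffordMatrix n j) s :=
  (LinearMap.congr_fun
    (Matrix.toLpLin_mul_same 2 (cliffordMatrix n i) (cliffordMatrix n j)) s).symm

theorem c_apply_c_self (j : Fin n) (s : Spinor n) : c j (c j s) = -s := by
  rw [c_apply_c, cliffordMatrix_mul_self, map_neg, Matrix.toLpLin_one]
  rfl

theorem c_apply_c_of_lt (h : i < j) (s : Spinor n) : c j (c i s) = -c i (c j s) := by
  rw [c_apply_c, c_apply_c, cliffordMatrix_mul_comm_of_lt h, map_neg, LinearMap.neg_apply, neg_neg]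

theorem inner_c_left (j : Fin n) (s t : Spinor n) : inner ℂ (c j s) t = -inner ℂ s (c j t) := by
  rw [c, ← LinearMap.adjoint_inner_right, ← Matrix.toEuclideanLin_conjTranspose_eq_adjoint,
    cliffordMatrix_conjTranspose, map_neg, LinearMap.neg_apply, inner_neg_right]

end CliffordMatrices

theorem sum_sum_eq_sum_Ioi_add_sum_diag {ι M : Type*} [Fintype ι] [LinearOrder ι]
    [LocallyFiniteOrderTop ι] [LocallyFiniteOrderBot ι] [AddCommMonoid M] (f : ι → ι → M) :
    ∑ i, ∑ j, f i j = (∑ i, ∑ j ∈ Finset.Ioi i, (f i j + f j i)) + ∑ i, f i i := by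
  rw [Finset.sum_sum_Ioi_add_eq_sum_sum_off_diag fun j i => f i j, ← Finset.sum_add_distrib]
  exact Finset.sum_congr rfl fun i _ => by
    rw [← Finset.sum_compl_add_sum {i}, Finset.sum_singleton]

theorem inner_eq_sum_mul {ι : Type*} [Fintype ι] (v w : EuclideanSpace ℝ ι) :
    ⟪v, w⟫ = ∑ i, v i * w i := by
  simp [PiLp.inner_apply, mul_comm]

section CliffordMap

variable {n : ℕ}

/-- The Clifford map `v ↦ √-1 c(v)` on spinors. -/
def cliffordMap (n : ℕ) : EuclideanSpace ℝ (Fin n) →L[ℝ] Spinor n →L[ℝ] Spinor n :=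
  ∑ j, (EuclideanSpace.proj j : EuclideanSpace ℝ (Fin n) →L[ℝ] ℝ).smulRight
    (LinearMap.toContinuousLinearMap ((Complex.I • c j).restrictScalars ℝ))

theorem cliffordMap_eq_sum (v : EuclideanSpace ℝ (Fin n)) (s : Spinor n) :
    cliffordMap n v s = ∑ j, v j • Complex.I • c j s := by
  simp [cliffordMap]

theorem cliffordMap_apply (v : EuclideanSpace ℝ (Fin n)) (s : Spinor n) :
    cliffordMap n v s = Complex.I • cliff v s := by
  simp only [cliffordMap_eq_sum, cliff, Finset.smul_sum, Complex.coe_smul, smul_comm Complex.I]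

theorem cliffordMap_apply_cliffordMap (v w : EuclideanSpace ℝ (Fin n)) (s : Spinor n) :
    cliffordMap n v (cliffordMap n w s) = -∑ i, ∑ j, (v i * w j) • c i (c j s) := by
  have hterm : ∀ i j, v i • Complex.I • c i (w j • Complex.I • c j s) =
      -((v i * w j) • c i (c j s)) := fun i j => by
    rw [LinearMap.map_smul_of_tower, map_smul, smul_comm Complex.I, smul_smul Complex.I,
      Complex.I_mul_I, neg_one_smul, smul_neg, smul_neg, smul_smul]
  simp only [cliffordMap_eq_sum, map_sum, hterm, Finset.sum_neg_distrib]
  rw [Finset.sum_comm]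

theorem sum_Ioi_smul_c_c (v w : EuclideanSpace ℝ (Fin n)) (s : Spinor n) :
    ∑ i, ∑ j ∈ Finset.Ioi i, (v i * w j - w i * v j) • c i (c j s) =
      ⟪v, w⟫ • s - cliffordMap n v (cliffordMap n w s) := by
  have hlt : ∀ i, ∀ j ∈ Finset.Ioi i, (v i * w j - w i * v j) • c i (c j s) =
      (v i * w j) • c i (c j s) + (v j * w i) • c j (c i s) := fun i j hij => by
    rw [c_apply_c_of_lt (Finset.mem_Ioi.mp hij)]
    module
  have hdiag : ∑ i, (v i * w i) • c i (c i s) = -(⟪v, w⟫ • s) := by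
    simp only [c_apply_c_self, smul_neg, Finset.sum_neg_distrib, inner_eq_sum_mul, Finset.sum_smul]
  rw [cliffordMap_apply_cliffordMap, sum_sum_eq_sum_Ioi_add_sum_diag, hdiag,
    Finset.sum_congr rfl fun i _ => Finset.sum_congr rfl (hlt i)]
  abel

theorem isClifford_cliffordMap : IsClifford (cliffordMap n) := fun v => by
  ext1 s
  have h := sum_Ioi_smul_c_c v v s
  simp only [sub_self, zero_smul, Finset.sum_const_zero, real_inner_self_eq_norm_sq] at h
  exact (sub_eq_zero.mp h.symm).symm

theorem inner_cliffordMap_left (v : EuclideanSpace ℝ (Fin n)) (s t : Spinor n) :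
    inner ℂ (cliffordMap n v s) t = inner ℂ s (cliffordMap n v t) := by
  simp only [cliffordMap_apply, cliff, inner_smul_left, inner_smul_right, sum_inner, inner_sum,
    inner_c_left, Complex.conj_ofReal, Complex.conj_I, mul_neg, neg_mul, Finset.sum_neg_distrib,
    neg_neg]

end CliffordMap

section ConformallyFlat

variable {n : ℕ} {g : EuclideanSpace ℝ (Fin n) → Matrix (Fin n) (Fin n) ℝ}
  {u : EuclideanSpace ℝ (Fin n) → ℝ} {ξ x : EuclideanSpace ℝ (Fin n)}

/-- The metric `g` is conformally flat near `x`, with conformal factor `u²`, and `ξ` is the gradient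
of `log |u|` at `x` with respect to the flat metric. -/
structure IsConformallyFlatAt (g : EuclideanSpace ℝ (Fin n) → Matrix (Fin n) (Fin n) ℝ)
    (u : EuclideanSpace ℝ (Fin n) → ℝ) (ξ x : EuclideanSpace ℝ (Fin n)) : Prop where
  eventually_eq : ∀ᶠ y in 𝓝 x, g y = u y ^ 2 • 1
  hasFDerivAt : HasFDerivAt u (u x • innerSL ℝ ξ) x
  ne_zero : u x ≠ 0

/-- The orthonormal frame of the metric `u² δ` that is proportional to the coordinate frame. -/
def conformalFrame (u : EuclideanSpace ℝ (Fin n) → ℝ) (i : Fin n) (x : EuclideanSpace ℝ (Fin n)) :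
    EuclideanSpace ℝ (Fin n) := (u x)⁻¹ • coordVec i

theorem inner_coordVec_right (V : EuclideanSpace ℝ (Fin n)) (i : Fin n) :
    ⟪V, coordVec i⟫ = V i := by
  simp [EuclideanSpace.inner_single_right]

namespace IsConformallyFlatAt

theorem metric_eq (h : IsConformallyFlatAt g u ξ x) : g x = u x ^ 2 • 1 :=
  h.eventually_eq.self_of_nhds

theorem metricInner_eq (h : IsConformallyFlatAt g u ξ x) (V W : EuclideanSpace ℝ (Fin n)) :
    metricInner g x V W = u x ^ 2 * ⟪V, W⟫ := by
  simp [metricInner, h.metric_eq, inner_eq_sum_mul, Matrix.one_apply, Finset.mul_sum, mul_assoc]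

theorem partialD_eq (h : IsConformallyFlatAt g u ξ x) (p i j : Fin n) :
    partialD p (fun y => g y i j) x =
      2 * u x ^ 2 * ξ p * (1 : Matrix (Fin n) (Fin n) ℝ) i j := by
  have hev : (fun y => g y i j) =ᶠ[𝓝 x] fun y => u y ^ 2 * (1 : Matrix (Fin n) (Fin n) ℝ) i j := by
    filter_upwards [h.eventually_eq] with y hy
    rw [hy, Matrix.smul_apply, smul_eq_mul]
  rw [partialD, (((h.hasFDerivAt.pow 2).mul_const _).congr_of_eventuallyEq hev).fderiv]
  simp only [smul_apply, innerSL_apply_apply, inner_coordVec_right, smul_eq_mul, nsmul_eq_mul]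
  push_cast
  ring

theorem inv_metric_eq (h : IsConformallyFlatAt g u ξ x) : (g x)⁻¹ = (u x ^ 2)⁻¹ • 1 := by
  rw [h.metric_eq]
  refine Matrix.inv_eq_left_inv ?_
  rw [smul_mul_smul_comm, one_mul, inv_mul_cancel₀ (pow_ne_zero 2 h.ne_zero), one_smul]

theorem christoffel_eq (h : IsConformallyFlatAt g u ξ x) (l i j : Fin n) :
    christoffel g x l i j = ξ i * (1 : Matrix (Fin n) (Fin n) ℝ) j l
      + ξ j * (1 : Matrix (Fin n) (Fin n) ℝ) i l - ξ l * (1 : Matrix (Fin n) (Fin n) ℝ) i j := by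
  have hsum : ∀ f : Fin n → ℝ, ∑ p, (1 : Matrix (Fin n) (Fin n) ℝ) l p * f p = f l := fun f => by
    simp [Matrix.one_apply]
  simp only [christoffel, h.inv_metric_eq, h.partialD_eq, Matrix.smul_apply, smul_eq_mul, mul_assoc,
    ← Finset.mul_sum, hsum]
  have hu := h.ne_zero
  field_simp

theorem sum_christoffel_mul (h : IsConformallyFlatAt g u ξ x) (V : EuclideanSpace ℝ (Fin n))
    (l j : Fin n) : ∑ i, christoffel g x l i j * V i =
      ⟪ξ, V⟫ * (1 : Matrix (Fin n) (Fin n) ℝ) j l + ξ j * V l - ξ l * V j := by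
  have hsplit : ∀ i, christoffel g x l i j * V i =
      ξ i * V i * (1 : Matrix (Fin n) (Fin n) ℝ) j l
        + ξ j * (V i * (1 : Matrix (Fin n) (Fin n) ℝ) i l)
        - ξ l * (V i * (1 : Matrix (Fin n) (Fin n) ℝ) i j) := fun i => by
    rw [h.christoffel_eq]
    ring
  simp only [hsplit, Finset.sum_sub_distrib, Finset.sum_add_distrib, ← Finset.sum_mul,
    ← Finset.mul_sum, inner_eq_sum_mul]
  simp [Matrix.one_apply]

theorem hasFDerivAt_conformalFrame (h : IsConformallyFlatAt g u ξ x) (j : Fin n) :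
    HasFDerivAt (conformalFrame u j) ((-(u x)⁻¹ • innerSL ℝ ξ).smulRight (coordVec j)) x := by
  refine (((hasDerivAt_inv h.ne_zero).comp_hasFDerivAt x h.hasFDerivAt).smul_const
    _).congr_fderiv ?_
  have hu := h.ne_zero
  rw [smul_smul]
  congr 2
  field_simp

theorem leviCivita_conformalFrame (h : IsConformallyFlatAt g u ξ x)
    (V : EuclideanSpace ℝ (Fin n)) (j : Fin n) :
    leviCivita g x V (conformalFrame u j) = (u x)⁻¹ • (ξ j • V - V j • ξ) := by
  ext l
  have hframe : ∀ p, (coordVec j : EuclideanSpace ℝ (Fin n)) p =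
      (1 : Matrix (Fin n) (Fin n) ℝ) j p := fun p => by simp [Matrix.one_apply, eq_comm]
  have hcontract : ∀ i, ∑ p, christoffel g x l i p * V i * conformalFrame u j x p =
      (u x)⁻¹ * (christoffel g x l i j * V i) := fun i => by
    simp [conformalFrame, mul_comm]
  simp only [leviCivita, (h.hasFDerivAt_conformalFrame j).fderiv, hcontract, ← Finset.mul_sum,
    h.sum_christoffel_mul, PiLp.add_apply, PiLp.sub_apply, PiLp.smul_apply, smul_apply,
    ContinuousLinearMap.smulRight_apply, innerSL_apply_apply, smul_eq_mul, hframe]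
  ring

theorem metricInner_leviCivita_conformalFrame (h : IsConformallyFlatAt g u ξ x)
    (V : EuclideanSpace ℝ (Fin n)) (j l : Fin n) :
    metricInner g x (leviCivita g x V (conformalFrame u j)) (conformalFrame u l x) =
      ξ j * V l - V j * ξ l := by
  have hu := h.ne_zero
  rw [h.metricInner_eq, h.leviCivita_conformalFrame, conformalFrame, real_inner_smul_left,
    real_inner_smul_right, inner_coordVec_right, PiLp.sub_apply, PiLp.smul_apply, PiLp.smul_apply,
    smul_eq_mul, smul_eq_mul]
  field_simp

theorem spinConnection_eq (h : IsConformallyFlatAt g u ξ x)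
    (ψ : EuclideanSpace ℝ (Fin n) → Spinor n) (V : EuclideanSpace ℝ (Fin n)) :
    spinConnection g (conformalFrame u) ψ x V = fderiv ℝ ψ x V +
      (1 / 2 : ℝ) • (⟪ξ, V⟫ • ψ x - cliffordMap n ξ (cliffordMap n V (ψ x))) := by
  simp only [spinConnection, h.metricInner_leviCivita_conformalFrame, Complex.coe_smul,
    Finset.filter_lt_eq_Ioi, sum_Ioi_smul_c_c]
  rw [← Complex.coe_smul (1 / 2)]
  push_cast
  rfl

theorem I_smul_cliffordMul (h : IsConformallyFlatAt g u ξ x) (V : EuclideanSpace ℝ (Fin n))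
    (s : Spinor n) :
    Complex.I • cliffordMul g (conformalFrame u) x V s = u x • cliffordMap n V s := by
  have hu := h.ne_zero
  rw [cliffordMul, cliffordMap_eq_sum, Finset.smul_sum, Finset.smul_sum]
  refine Finset.sum_congr rfl fun j _ => ?_
  rw [h.metricInner_eq, conformalFrame, real_inner_smul_right, inner_coordVec_right,
    Complex.coe_smul, smul_comm Complex.I, smul_smul]
  congr 1
  field_simp

end IsConformallyFlatAt

end ConformallyFlat

section HyperbolicMetric

variable {n : ℕ} {k : ℝ} {x : EuclideanSpace ℝ (Fin n)}

/-- The factor `u` for which the hyperbolic metric is `u² δ` in ball coordinates. -/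
def ballFactor (k : ℝ) (x : EuclideanSpace ℝ (Fin n)) : ℝ := 2 / k / (1 - ‖x‖ ^ 2)

theorem hypFrame_eq_conformalFrame (k : ℝ) :
    hypFrame (n := n) k = conformalFrame (ballFactor k) := by
  ext1 i
  ext1 x
  rw [hypFrame, conformalFrame, ballFactor, div_div, inv_div]

theorem hasFDerivAt_ballFactor (k : ℝ) (hx : 1 - ‖x‖ ^ 2 ≠ 0) :
    HasFDerivAt (ballFactor k) (ballFactor k x • innerSL ℝ ((2 / (1 - ‖x‖ ^ 2)) • x)) x :=
  hasFDerivAt_const_div_one_sub_norm_sq (2 / k) hx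

theorem ofBall_eq (hk : k ≠ 0) (hx : 1 - ‖x‖ ^ 2 ≠ 0) :
    ofBall k x = (ballFactor k x • x, ballFactor k x - 1 / k) := by
  have hspace : 1 / k * (2 / (1 - ‖x‖ ^ 2)) = ballFactor k x := by
    rw [ballFactor]
    ring
  have htime : 1 / k * ((1 + ‖x‖ ^ 2) / (1 - ‖x‖ ^ 2)) = ballFactor k x - 1 / k := by
    rw [ballFactor]
    field_simp
    ring
  rw [ofBall, hspace, htime]

theorem fderiv_ofBall (hk : k ≠ 0) (hx : 1 - ‖x‖ ^ 2 ≠ 0) (V : EuclideanSpace ℝ (Fin n)) :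
    fderiv ℝ (ofBall k) x V =
      ballFactor k x • (V + (2 / (1 - ‖x‖ ^ 2) * ⟪x, V⟫) • x, 2 / (1 - ‖x‖ ^ 2) * ⟪x, V⟫) := by
  have hev : ofBall k =ᶠ[𝓝 x] fun y => (ballFactor k y • id y, ballFactor k y - 1 / k) :=
    (eventually_one_sub_norm_sq_ne_zero hx).mono fun y hy => ofBall_eq hk hy
  have hu := hasFDerivAt_ballFactor k hx
  rw [hev.fderiv_eq, ((hu.fun_smul (hasFDerivAt_id x)).prodMk (hu.sub_const (1 / k))).fderiv]
  simp [mul_smul]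

theorem lorentz_eq (P Q : Minkowski n) : lorentz P Q = ⟪P.1, Q.1⟫ - P.2 * Q.2 := by
  rw [lorentz, inner_eq_sum_mul]

theorem lorentz_fderiv_ofBall (hk : k ≠ 0) (hx : 1 - ‖x‖ ^ 2 ≠ 0)
    (V W : EuclideanSpace ℝ (Fin n)) :
    lorentz (fderiv ℝ (ofBall k) x V) (fderiv ℝ (ofBall k) x W) =
      ballFactor k x ^ 2 * ⟪V, W⟫ := by
  simp only [fderiv_ofBall hk hx, lorentz_eq, Prod.smul_fst, Prod.smul_snd, inner_add_left,
    inner_add_right, real_inner_smul_left, real_inner_smul_right, real_inner_self_eq_norm_sq,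
    real_inner_comm x V, smul_eq_mul]
  field_simp
  ring

theorem hypMetric_eq (hk : k ≠ 0) (hx : 1 - ‖x‖ ^ 2 ≠ 0) :
    hypMetric k x = ballFactor k x ^ 2 • 1 := by
  ext i j
  rw [hypMetric, lorentz_fderiv_ofBall hk hx, Matrix.smul_apply, smul_eq_mul, inner_coordVec_right]
  simp [Matrix.one_apply, eq_comm]

theorem isConformallyFlatAt_hypMetric (hk : k ≠ 0) (hx : 1 - ‖x‖ ^ 2 ≠ 0) :
    IsConformallyFlatAt (hypMetric k) (ballFactor k) ((2 / (1 - ‖x‖ ^ 2)) • x) x where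
  eventually_eq := (eventually_one_sub_norm_sq_ne_zero hx).mono fun _ hy => hypMetric_eq hk hy
  hasFDerivAt := hasFDerivAt_ballFactor k hx
  ne_zero := div_ne_zero (div_ne_zero two_ne_zero hk) hx

theorem spinConnection_add_cliffordMul (hk : k ≠ 0) (hx : 1 - ‖x‖ ^ 2 ≠ 0)
    (ψ : EuclideanSpace ℝ (Fin n) → Spinor n) (V : EuclideanSpace ℝ (Fin n)) :
    spinConnection (hypMetric k) (hypFrame k) ψ x V
      + (Complex.I / 2 * (k : ℂ)) • cliffordMul (hypMetric k) (hypFrame k) x V (ψ x) =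
    fderiv ℝ ψ x V - killingForm (cliffordMap n) x V (ψ x) := by
  have hflat := isConformallyFlatAt_hypMetric hk hx
  have hI : Complex.I / 2 * (k : ℂ) = ((k / 2 : ℝ) : ℂ) * Complex.I := by
    push_cast
    ring
  rw [hypFrame_eq_conformalFrame, hflat.spinConnection_eq, hI, mul_smul, Complex.coe_smul,
    hflat.I_smul_cliffordMul, killingForm_apply, ballFactor]
  simp only [map_smul, real_inner_smul_left, smul_apply, sub_apply,
    mul_apply_eq_comp, one_apply_eq_self]
  match_scalars <;> field_simp

end HyperbolicMetric

section Hyperboloid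

variable {n : ℕ} {k : ℝ} {x : EuclideanSpace ℝ (Fin n)} {P : Minkowski n}

theorem toBall_ofBall (hk : k ≠ 0) (hx : 1 - ‖x‖ ^ 2 ≠ 0) : toBall k (ofBall k x) = x := by
  have hscale : k / (1 + k * (ballFactor k x - 1 / k)) * ballFactor k x = 1 := by
    rw [ballFactor]
    field_simp
    ring
  rw [ofBall_eq hk hx, toBall, smul_smul, hscale, one_smul]

theorem one_sub_norm_toBall_sq (hk : 0 < k) (hP : P ∈ hyperboloid n k) :
    1 - ‖toBall k P‖ ^ 2 = 2 / (1 + k * P.2) := by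
  obtain ⟨hlorentz, ht⟩ := hP
  rw [← EuclideanSpace.real_norm_sq_eq, sub_eq_iff_eq_add] at hlorentz
  rw [toBall, norm_smul, mul_pow, Real.norm_eq_abs, sq_abs, hlorentz]
  field_simp
  ring

theorem toBall_mem_ball (hk : 0 < k) (hP : P ∈ hyperboloid n k) :
    toBall k P ∈ Metric.ball 0 1 := by
  have ht := hP.2
  rw [mem_ball_zero_iff, ← sq_lt_one_iff₀ (norm_nonneg _), ← sub_pos,
    one_sub_norm_toBall_sq hk hP]
  positivity

theorem ofBall_toBall (hk : 0 < k) (hP : P ∈ hyperboloid n k) : ofBall k (toBall k P) = P := by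
  have ht := hP.2
  have hfactor : ballFactor k (toBall k P) = (1 + k * P.2) / k := by
    rw [ballFactor, one_sub_norm_toBall_sq hk hP]
    field_simp
  rw [ofBall_eq hk.ne' (one_sub_norm_sq_pos (toBall_mem_ball hk hP)).ne', hfactor]
  refine Prod.ext ?_ ?_
  · rw [toBall, smul_smul, div_mul_div_cancel₀ hk.ne', div_self (by positivity), one_smul]
  · dsimp only
    field_simp
    ring

theorem ofBall_zero_mem_hyperboloid (hk : 0 < k) : ofBall k 0 ∈ hyperboloid n k := by
  simp [ofBall, hyperboloid, hk]

end Hyperboloid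

section KillingSpinors

variable {n : ℕ} {k : ℝ} {P : Minkowski n}

theorem killingSpinor_eq (k : ℝ) (a : Spinor n) (P : Minkowski n) :
    killingSpinor k a P = killingPropagator (cliffordMap n) (toBall k P) a := by
  rw [killingSpinor, Complex.coe_smul, ← cliffordMap_apply]
  rfl

theorem killingSpinor_injective (hk : 0 < k) (hP : P ∈ hyperboloid n k) :
    Function.Injective fun a : Spinor n => killingSpinor k a P := by
  simpa only [killingSpinor_eq] using
    isClifford_cliffordMap.killingPropagator_injective (toBall_mem_ball hk hP)

theorem isKillingSpinor_iff (hk : k ≠ 0) (φ : Minkowski n → Spinor n) :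
    IsKillingSpinor k φ ↔ ContDiffOn ℝ ∞ (fun x => φ (ofBall k x)) (Metric.ball 0 1) ∧
      ∀ x ∈ Metric.ball 0 1, HasFDerivAt (fun y => φ (ofBall k y))
        ((killingForm (cliffordMap n) x).flip (φ (ofBall k x))) x := by
  refine and_congr_right fun hφ => forall₂_congr fun x hx => ?_
  have hdiff : DifferentiableAt ℝ (fun y => φ (ofBall k y)) x :=
    (hφ.contDiffAt (Metric.isOpen_ball.mem_nhds hx)).differentiableAt (by simp)
  simp only [spinConnection_add_cliffordMul hk (one_sub_norm_sq_pos hx).ne'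
    (fun y => φ (ofBall k y)), sub_eq_zero]
  exact ⟨fun h => hdiff.hasFDerivAt.congr_fderiv (ContinuousLinearMap.ext h),
    fun h V => DFunLike.congr_fun h.fderiv V⟩

theorem isKillingSpinor_killingSpinor (hk : k ≠ 0) (a : Spinor n) :
    IsKillingSpinor k (killingSpinor k a) := by
  have hball : ∀ x ∈ Metric.ball (0 : EuclideanSpace ℝ (Fin n)) 1,
      killingSpinor k a (ofBall k x) = killingPropagator (cliffordMap n) x a := fun x hx => by
    rw [killingSpinor_eq, toBall_ofBall hk (one_sub_norm_sq_pos hx).ne']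
  refine (isKillingSpinor_iff hk _).mpr ⟨?_, fun x hx => ?_⟩
  · exact ((contDiffOn_killingPropagator _).clm_apply contDiffOn_const).congr hball
  · rw [hball x hx]
    exact (isClifford_cliffordMap.hasFDerivAt_killingPropagator_apply hx a).congr_of_eventuallyEq
      (Filter.eventually_of_mem (Metric.isOpen_ball.mem_nhds hx) hball)

theorem IsKillingSpinor.exists_eqOn_killingSpinor (hk : 0 < k) {ψ : Minkowski n → Spinor n}
    (hψ : IsKillingSpinor k ψ) : ∃ b, Set.EqOn ψ (killingSpinor k b) (hyperboloid n k) := by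
  obtain ⟨b, hb⟩ := isClifford_cliffordMap.exists_eqOn_killingPropagator
    ((isKillingSpinor_iff hk.ne' ψ).mp hψ).2
  refine ⟨b, fun P hP => ?_⟩
  have hψP := hb (toBall_mem_ball hk hP)
  simp only [ofBall_toBall hk hP] at hψP
  rw [hψP, killingSpinor_eq]

theorem inner_zeta_fst (x : EuclideanSpace ℝ (Fin n)) (a : Spinor n) :
    ⟪x, (zeta a).1⟫ = RCLike.re (inner ℂ a (cliffordMap n x a)) := by
  rw [inner_eq_sum_mul, cliffordMap_eq_sum, inner_sum, map_sum]
  refine Finset.sum_congr rfl fun j _ => ?_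
  rw [inner_smul_right_eq_smul, RCLike.smul_re]
  rfl

theorem zeta_snd_eq_norm_sq (a : Spinor n) : (zeta a).2 = ‖a‖ ^ 2 := by
  rw [zeta, smul_smul, Complex.I_mul_I, neg_one_smul, inner_neg_right, Complex.neg_re, neg_neg]
  exact inner_self_eq_norm_sq (𝕜 := ℂ) a

theorem norm_killingSpinor_sq (hk : 0 < k) (a : Spinor n) (hP : P ∈ hyperboloid n k) :
    ‖killingSpinor k a P‖ ^ 2 = -2 * k * lorentz P (zeta a) := by
  have hx := toBall_mem_ball hk hP
  have hr := (one_sub_norm_sq_pos hx).ne'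
  conv_rhs => rw [← ofBall_toBall hk hP, ofBall_eq hk.ne' hr]
  rw [killingSpinor_eq, isClifford_cliffordMap.norm_killingPropagator_sq (𝕜 := ℂ) hx
    (inner_cliffordMap_left _), lorentz_eq, real_inner_smul_left, inner_zeta_fst,
    zeta_snd_eq_norm_sq, ballFactor]
  field_simp
  ring

end KillingSpinors

end HyperbolicSpinor

end

theorem proposition3p3 (n : ℕ) (k : ℝ) (hk : 0 < k) (a : HyperbolicSpinor.Spinor n) :
    HyperbolicSpinor.IsKillingSpinor k (HyperbolicSpinor.killingSpinor k a) ∧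
    (∀ ψ : HyperbolicSpinor.Minkowski n → HyperbolicSpinor.Spinor n, HyperbolicSpinor.IsKillingSpinor k ψ →
      ∃! b : HyperbolicSpinor.Spinor n, Set.EqOn ψ (HyperbolicSpinor.killingSpinor k b) (HyperbolicSpinor.hyperboloid n k)) ∧
    ∀ X ∈ HyperbolicSpinor.hyperboloid n k, ‖HyperbolicSpinor.killingSpinor k a X‖ ^ 2 = -2 * k * HyperbolicSpinor.lorentz X (HyperbolicSpinor.zeta a) := by
  refine ⟨HyperbolicSpinor.isKillingSpinor_killingSpinor hk.ne' a, fun ψ hψ => ?_,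
    fun X hX => HyperbolicSpinor.norm_killingSpinor_sq hk a hX⟩
  obtain ⟨b, hb⟩ := hψ.exists_eqOn_killingSpinor hk
  have hmem := HyperbolicSpinor.ofBall_zero_mem_hyperboloid (n := n) hk
  exact ⟨b, hb, fun b' hb' =>
    HyperbolicSpinor.killingSpinor_injective hk hmem ((hb' hmem).symm.trans (hb hmem))⟩
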